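/- Let $G$ be a virtually abelian group (that is, $G$ has an abelian subgroup of finite index), let $S\subseteq G$ be a finite set that generates $G$ as a monoid, and let $\omega\colon S\to\{1,2,3,\ldots\}$ be any weight function. The weight of a word $s_1s_2\cdots s_k$ over $S$ is $\omega(s_1)+\cdots+\omega(s_k)$ (the empty word has weight $0$), and the weight $\omega(g)$ of an element $g\in G$ is the minimal weight of a word over $S$ that represents $g$. Let $H_1,\ldots,H_k$ be finitely many subgroups of $G$ and let $U=H_1\cup\cdots\cup H_k$. Then the weighted growth series of $U$ relative to $G$, \[\sum_{n=0}^{\infty}\#\{g\in U\mid \omega(g)=n\}\,z^n,\] is a rational function, i.e. it equals $p(z)/q(z)$ as a formal power series for some polynomials $p,q$ with integer coefficients, $q\neq 0$. -/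

import Mathlib

namespace WeightedGrowth

/-- A group is virtually abelian if it has an abelian subgroup of finite index. -/
def IsVirtuallyAbelian (G : Type*) [Group G] : Prop :=
  ∃ A : Subgroup G, IsMulCommutative A ∧ A.FiniteIndex

section

variable {G : Type*} [Group G] {S : Finset G}

/-- The element of `G` represented by a word over `S`. -/
def wordValue (w : List S) : G := (w.map Subtype.val).prod

/-- The weight of a word: the sum of the weights of its letters (so the empty word has weight 0). -/
def wordWeight (ω : S → ℕ) (w : List S) : ℕ := (w.map ω).sum

/-- The weight of a group element: the minimal weight of a word over `S` representing it
(used only when every element is represented by some word). -/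
noncomputable def weight (ω : S → ℕ) (g : G) : ℕ :=
  sInf {n : ℕ | ∃ w : List S, wordValue w = g ∧ wordWeight ω w = n}

/-- The relative weighted growth function of `U`: the number of elements of `U` of weight
exactly `n` with respect to the weighted generating set of `G`. -/
noncomputable def relGrowth (ω : S → ℕ) (U : Set G) (n : ℕ) : ℕ :=
  Set.ncard {g : G | g ∈ U ∧ weight ω g = n}

/-- The relative weighted growth series `∑ n, relGrowth ω U n * z ^ n`. -/
noncomputable def relGrowthSeries (ω : S → ℕ) (U : Set G) : PowerSeries ℤ :=
  PowerSeries.mk fun n => (relGrowth ω U n : ℤ)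

/-- If `S` generates `G` as a monoid, the minimal weight of an element is attained by a word. -/
theorem exists_word_weight (hS : Submonoid.closure (S : Set G) = ⊤) (ω : S → ℕ) (g : G) :
    ∃ w : List S, wordValue w = g ∧ wordWeight ω w = weight ω g := by
  have hg : g ∈ Submonoid.closure (S : Set G) := hS ▸ Submonoid.mem_top g
  obtain ⟨l, hl, rfl⟩ := Submonoid.exists_list_of_mem_closure hg
  have hw : wordValue (S := S) (l.attach.map fun x => ⟨x.1, hl x.1 x.2⟩) = l.prod := by
    simp [wordValue, List.map_map, Function.comp_def]
  exact Nat.sInf_mem (s := {n : ℕ | ∃ w : List S, wordValue w = l.prod ∧ wordWeight ω w = n})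
    ⟨_, _, hw, rfl⟩

/-- The sets counted by `relGrowth` are finite, so the cardinality there is the true one. -/
theorem finite_weight_eq (hS : Submonoid.closure (S : Set G) = ⊤) (ω : S → ℕ)
    (hω : ∀ s, 0 < ω s) (U : Set G) (n : ℕ) : {g : G | g ∈ U ∧ weight ω g = n}.Finite := by
  refine ((List.finite_length_le S n).image wordValue).subset ?_
  rintro g ⟨-, hg⟩
  obtain ⟨w, hw, hwt⟩ := exists_word_weight hS ω g
  refine ⟨w, ?_, hw⟩
  have key : ∀ v : List S, v.length ≤ wordWeight ω v := by
    intro v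
    induction v with
    | nil => simp [wordWeight]
    | cons a t ih =>
      have := hω a
      simp only [wordWeight, List.map_cons, List.sum_cons, List.length_cons] at ih ⊢
      omega
  exact (key w).trans (hwt.trans hg).le

end

/-- A power series `f` with integer coefficients is rational if `f = p / q` for polynomials
`p`, `q` with integer coefficients, `q ≠ 0`. -/
def IsRationalSeries (f : PowerSeries ℤ) : Prop :=
  ∃ p q : Polynomial ℤ, q ≠ 0 ∧ (q : PowerSeries ℤ) * f = (p : PowerSeries ℤ)

end WeightedGrowth

/-!
Let `A` be an abelian subgroup of finite index. Reading a word over `S` letter by letter moves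
between the finitely many cosets of `A` and adds up coordinates in `A`, so by Kleene's recursion the
pairs (coordinate, weight) of the words ending in a given coset form a semilinear subset of
`A × ℕ`. As semilinear sets are closed under differences, the pairs of least weight, which make up
the graph of the weight function, again form a semilinear set. A subgroup of `G` meets each coset
of `A` in a translate of a subgroup of `A` or not at all, so restricting the graph to it preserves
semilinearity.

A semilinear set on which a degree has finite fibres has a rational counting series: it is a
finite union of translates of finitely generated monoids of positive degree, a class closed under
intersection, which reduces the count to a single translate. Choosing the lexicographically least
representation of each element then leaves a complement of an upper set of `ℕ ^ n` to be counted,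
and upper sets are finite unions of translated orthants.
-/

namespace WeightedGrowth

open AddSubmonoid Pointwise

section Rational

theorem isRationalSeries_coe (p : Polynomial ℤ) : IsRationalSeries (p : PowerSeries ℤ) :=
  ⟨p, 1, one_ne_zero, by simp⟩

theorem isRationalSeries_zero : IsRationalSeries 0 := by
  simpa using isRationalSeries_coe 0

theorem isRationalSeries_X_pow (n : ℕ) : IsRationalSeries (PowerSeries.X ^ n) := by
  simpa using isRationalSeries_coe (Polynomial.X ^ n)

variable {f g : PowerSeries ℤ}

theorem IsRationalSeries.add (hf : IsRationalSeries f) (hg : IsRationalSeries g) :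
    IsRationalSeries (f + g) := by
  obtain ⟨p, q, hq, h⟩ := hf
  obtain ⟨p', q', hq', h'⟩ := hg
  refine ⟨p * q' + p' * q, q * q', mul_ne_zero hq hq', ?_⟩
  push_cast
  rw [← h, ← h']
  ring

theorem IsRationalSeries.mul (hf : IsRationalSeries f) (hg : IsRationalSeries g) :
    IsRationalSeries (f * g) := by
  obtain ⟨p, q, hq, h⟩ := hf
  obtain ⟨p', q', hq', h'⟩ := hg
  refine ⟨p * p', q * q', mul_ne_zero hq hq', ?_⟩
  push_cast
  rw [← h, ← h']
  ring

theorem IsRationalSeries.sub (hf : IsRationalSeries f) (hg : IsRationalSeries g) :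
    IsRationalSeries (f - g) := by
  rw [sub_eq_add_neg, ← neg_one_mul g]
  exact hf.add (.mul (by simpa using isRationalSeries_coe (-1)) hg)

theorem isRationalSeries_sum {κ : Type*} (t : Finset κ) {f : κ → PowerSeries ℤ}
    (hf : ∀ i ∈ t, IsRationalSeries (f i)) : IsRationalSeries (∑ i ∈ t, f i) :=
  Finset.sum_induction f IsRationalSeries (fun _ _ => .add) isRationalSeries_zero hf

theorem IsRationalSeries.of_eq_add_X_pow_mul {w : ℕ} (hw : 0 < w) (hg : IsRationalSeries g)
    (h : f = g + PowerSeries.X ^ w * f) : IsRationalSeries f := by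
  obtain ⟨p, q, hq, hpq⟩ := hg
  have hw_ne : (1 - Polynomial.X ^ w : Polynomial ℤ) ≠ 0 := fun h₀ => by
    simpa [hw.ne'] using congrArg (Polynomial.eval 0) h₀
  refine ⟨p, q * (1 - Polynomial.X ^ w), mul_ne_zero hq hw_ne, ?_⟩
  have hg_eq : (1 - PowerSeries.X ^ w) * f = g := by
    rw [sub_mul, one_mul, sub_eq_iff_eq_add]
    exact h
  rw [← hpq, ← hg_eq, ← mul_assoc]
  simp

end Rational

section Counting

variable {B C : Type*}

/-- The level sets of `ℓ` on `X` are finite, so that `countSeries ℓ X` counts them faithfully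
(`Set.ncard` of an infinite set is `0`). -/
def FiniteFibers (ℓ : B → ℕ) (X : Set B) : Prop := ∀ n, {x | x ∈ X ∧ ℓ x = n}.Finite

/-- The generating series `∑ n, #{x ∈ X | ℓ x = n} * z ^ n` of `X` graded by `ℓ`. It unfolds to
`relGrowthSeries ω X` when `ℓ = weight ω`. -/
noncomputable def countSeries (ℓ : B → ℕ) (X : Set B) : PowerSeries ℤ :=
  PowerSeries.mk fun n => ({x | x ∈ X ∧ ℓ x = n}.ncard : ℤ)

variable {ℓ : B → ℕ} {X Y : Set B} {f : C → B} {Z : Set C} {ℓ' : C → ℕ} {c : ℕ}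

theorem FiniteFibers.mono (hY : FiniteFibers ℓ Y) (h : X ⊆ Y) : FiniteFibers ℓ X :=
  fun n => (hY n).subset fun _ hx => ⟨h hx.1, hx.2⟩

theorem FiniteFibers.iUnion {κ : Type*} [Finite κ] {X : κ → Set B}
    (hX : ∀ i, FiniteFibers ℓ (X i)) : FiniteFibers ℓ (⋃ i, X i) := by
  intro n
  refine (Set.finite_iUnion fun i => hX i n).subset ?_
  rintro x ⟨hx, hxn⟩
  obtain ⟨i, hi⟩ := Set.mem_iUnion.1 hx
  exact Set.mem_iUnion.2 ⟨i, hi, hxn⟩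

theorem FiniteFibers.biUnion {κ : Type*} {s : Set κ} (hs : s.Finite) {X : κ → Set B}
    (hX : ∀ i ∈ s, FiniteFibers ℓ (X i)) : FiniteFibers ℓ (⋃ i ∈ s, X i) := by
  have := hs.to_subtype
  rw [Set.biUnion_eq_iUnion]
  exact .iUnion fun i => hX i i.2

theorem setOfPred_mem_image_and_eq (hf : ∀ z ∈ Z, ℓ (f z) = c + ℓ' z) (n : ℕ) :
    {x | x ∈ f '' Z ∧ ℓ x = n} = f '' {z | z ∈ Z ∧ c + ℓ' z = n} := by
  ext x
  constructor
  · rintro ⟨⟨z, hz, rfl⟩, hn⟩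
    exact ⟨z, ⟨hz, hf z hz ▸ hn⟩, rfl⟩
  · rintro ⟨z, ⟨hz, hn⟩, rfl⟩
    exact ⟨⟨z, hz, rfl⟩, (hf z hz).trans hn⟩

theorem FiniteFibers.image (hZ : FiniteFibers ℓ' Z) (hf : ∀ z ∈ Z, ℓ (f z) = c + ℓ' z) :
    FiniteFibers ℓ (f '' Z) := by
  intro n
  rw [setOfPred_mem_image_and_eq hf]
  exact ((hZ (n - c)).subset fun z hz => ⟨hz.1, by have := hz.2; omega⟩).image f

theorem FiniteFibers.of_image (h : FiniteFibers ℓ (f '' Z)) (hinj : Set.InjOn f Z)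
    (hf : ∀ z ∈ Z, ℓ (f z) = c + ℓ' z) : FiniteFibers ℓ' Z := by
  intro n
  have hn := h (c + n)
  rw [setOfPred_mem_image_and_eq hf] at hn
  exact (hn.of_finite_image (hinj.mono fun z hz => hz.1)).subset
    fun z hz => ⟨hz.1, congrArg (c + ·) hz.2⟩

theorem countSeries_image (hinj : Set.InjOn f Z) (hf : ∀ z ∈ Z, ℓ (f z) = c + ℓ' z) :
    countSeries ℓ (f '' Z) = PowerSeries.X ^ c * countSeries ℓ' Z := by
  ext n
  rw [PowerSeries.coeff_X_pow_mul', countSeries, countSeries, PowerSeries.coeff_mk,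
    PowerSeries.coeff_mk, setOfPred_mem_image_and_eq hf, (hinj.mono fun z hz => hz.1).ncard_image]
  split_ifs with hc
  · congr! 5 with z
    omega
  · have hempty : {z | z ∈ Z ∧ c + ℓ' z = n} = ∅ :=
      Set.eq_empty_of_forall_notMem fun z hz => by have := hz.2; omega
    rw [hempty, Set.ncard_empty, Nat.cast_zero]

@[simp]
theorem countSeries_empty : countSeries ℓ ∅ = 0 := by
  ext n
  simp [countSeries]

theorem countSeries_singleton (x : B) : countSeries ℓ {x} = PowerSeries.X ^ ℓ x := by
  ext n
  rw [countSeries, PowerSeries.coeff_mk, PowerSeries.coeff_X_pow]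
  split_ifs with h
  · have hfiber : {y | y ∈ ({x} : Set B) ∧ ℓ y = n} = {x} :=
      Set.inter_eq_left.2 (Set.singleton_subset_iff.2 h.symm)
    rw [hfiber, Set.ncard_singleton, Nat.cast_one]
  · have hfiber : {y | y ∈ ({x} : Set B) ∧ ℓ y = n} = ∅ :=
      Set.singleton_inter_eq_empty.2 fun hx => h hx.symm
    rw [hfiber, Set.ncard_empty, Nat.cast_zero]

theorem countSeries_union_add_inter (hX : FiniteFibers ℓ X) (hY : FiniteFibers ℓ Y) :
    countSeries ℓ (X ∪ Y) + countSeries ℓ (X ∩ Y) = countSeries ℓ X + countSeries ℓ Y := by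
  ext n
  have hunion : {x | x ∈ X ∪ Y ∧ ℓ x = n} = {x | x ∈ X ∧ ℓ x = n} ∪ {x | x ∈ Y ∧ ℓ x = n} :=
    Set.union_inter_distrib_right X Y {x | ℓ x = n}
  have hinter : {x | x ∈ X ∩ Y ∧ ℓ x = n} = {x | x ∈ X ∧ ℓ x = n} ∩ {x | x ∈ Y ∧ ℓ x = n} :=
    Set.inter_inter_distrib_right X Y {x | ℓ x = n}
  simp only [countSeries, map_add, PowerSeries.coeff_mk, hunion, hinter]
  exact_mod_cast Set.ncard_union_add_ncard_inter _ _ (hX n) (hY n)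

theorem countSeries_union (hX : FiniteFibers ℓ X) (hY : FiniteFibers ℓ Y) (h : Disjoint X Y) :
    countSeries ℓ (X ∪ Y) = countSeries ℓ X + countSeries ℓ Y := by
  rw [← countSeries_union_add_inter hX hY, h.inter_eq, countSeries_empty, add_zero]

theorem countSeries_iUnion {κ : Type*} [Fintype κ] {X : κ → Set B}
    (hX : ∀ i, FiniteFibers ℓ (X i)) (h : Pairwise (Function.onFun Disjoint X)) :
    countSeries ℓ (⋃ i, X i) = ∑ i, countSeries ℓ (X i) := by
  ext n
  have hUnion : {x | x ∈ ⋃ i, X i ∧ ℓ x = n} = ⋃ i, {x | x ∈ X i ∧ ℓ x = n} :=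
    Set.iUnion_inter {x | ℓ x = n} X
  have hdisj : Pairwise (Function.onFun Disjoint fun i => {x | x ∈ X i ∧ ℓ x = n}) :=
    fun i j hij => (h hij).mono (fun _ hx => hx.1) fun _ hx => hx.1
  simp only [countSeries, map_sum, PowerSeries.coeff_mk, hUnion,
    Set.ncard_iUnion_of_finite (fun i => hX i n) hdisj, finsum_eq_sum_of_fintype, Nat.cast_sum]

theorem isRationalSeries_countSeries_biUnion {𝒞 : Set (Set B)} (hinter : InfClosed 𝒞)
    (hfin : ∀ X ∈ 𝒞, FiniteFibers ℓ X) (hrat : ∀ X ∈ 𝒞, IsRationalSeries (countSeries ℓ X))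
    {κ : Type*} {s : Set κ} (hs : s.Finite) {X : κ → Set B} (hX : ∀ i ∈ s, X i ∈ 𝒞) :
    IsRationalSeries (countSeries ℓ (⋃ i ∈ s, X i)) := by
  induction s, hs using Set.Finite.induction_on generalizing X with
  | empty => simpa using isRationalSeries_zero
  | @insert a s _ hs ih =>
    simp only [Set.mem_insert_iff, forall_eq_or_imp] at hX
    have hcount := countSeries_union_add_inter (hfin _ hX.1)
      (.biUnion hs fun i hi => hfin _ (hX.2 i hi))
    rw [Set.inter_iUnion₂] at hcount
    rw [Set.biUnion_insert, eq_sub_of_add_eq hcount]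
    exact ((hrat _ hX.1).add (ih hX.2)).sub (ih fun i hi => hinter hX.1 (hX.2 i hi))

end Counting

section Orthant

variable {M : Type*} [PartialOrder M] [WellQuasiOrderedLE M]

theorem finite_setOfPred_minimal_mem (E : Set M) : {z | Minimal (· ∈ E) z}.Finite :=
  (setOfPred_minimal_antichain _).finite_of_partiallyWellOrderedOn
    ((Set.isPWO_of_wellQuasiOrderedLE E).mono (setOfPred_minimal_subset _))

theorem exists_finite_eq_biUnion_Ici {U : Set M} (hU : IsUpperSet U) :
    ∃ K : Set M, K.Finite ∧ U = ⋃ k ∈ K, Set.Ici k := by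
  refine ⟨_, finite_setOfPred_minimal_mem U, Set.Subset.antisymm (fun u hu => ?_) ?_⟩
  · obtain ⟨k, hku, hk⟩ := exists_minimal_le_of_wellFoundedLT (· ∈ U) u hu
    exact Set.mem_biUnion hk hku
  · exact Set.iUnion₂_subset fun k hk => hU.Ici_subset hk.prop

variable {ι : Type*} [DecidableEq ι] {d : (ι → ℕ) →+ ℕ}

theorem single_le_of_le_apply {u : ι → ℕ} {i : ι} {n : ℕ} (h : n ≤ u i) : Pi.single i n ≤ u :=
  update_le_iff.2 ⟨h, fun _ _ => zero_le⟩

theorem apply_le_of_pos_single (hd : ∀ i, 0 < d (Pi.single i 1)) (u : ι → ℕ) (i : ι) :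
    u i ≤ d u := by
  obtain ⟨v, hv⟩ := exists_add_of_le (single_le_of_le_apply (le_refl (u i)))
  have hsingle : d (Pi.single i (u i)) = u i * d (Pi.single i 1) := by
    rw [← smul_eq_mul, ← map_nsmul, ← Pi.single_smul, smul_eq_mul, mul_one]
  calc u i ≤ u i * d (Pi.single i 1) := Nat.le_mul_of_pos_right _ (hd i)
    _ ≤ d (Pi.single i (u i)) + d v := hsingle ▸ Nat.le_add_right _ _
    _ = d u := by rw [← map_add, ← hv]

variable [Finite ι]

theorem finiteFibers_orthant (hd : ∀ i, 0 < d (Pi.single i 1)) (X : Set (ι → ℕ)) :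
    FiniteFibers d X := by
  have := Fintype.ofFinite ι
  exact fun n => (Set.finite_Iic fun _ : ι => n).subset
    fun u hu i => hu.2 ▸ apply_le_of_pos_single hd u i

/-- The face `{u | supp u ⊆ insert i t}` is the disjoint union of the face `{u | supp u ⊆ t}` and
its own translate by the `i`-th basis vector. -/
theorem isRationalSeries_countSeries_face (hd : ∀ i, 0 < d (Pi.single i 1)) (t : Finset ι) :
    IsRationalSeries (countSeries d {u | ∀ i ∉ t, u i = 0}) := by
  induction t using Finset.induction_on with
  | empty =>
    have hface : {u : ι → ℕ | ∀ i ∉ (∅ : Finset ι), u i = 0} = {0} := by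
      ext u
      simp [funext_iff]
    rw [hface, countSeries_singleton]
    exact isRationalSeries_X_pow _
  | insert i t hi ih =>
    set E : Set (ι → ℕ) := {u | ∀ j ∉ t, u j = 0}
    set E' : Set (ι → ℕ) := {u | ∀ j ∉ insert i t, u j = 0}
    have hE' : E' = E ∪ (Pi.single i 1 + ·) '' E' := by
      ext u
      constructor
      · intro hu
        rcases Nat.eq_zero_or_pos (u i) with hui | hui
        · refine .inl fun j hj => ?_
          rcases eq_or_ne j i with rfl | hji
          · exact hui
          · exact hu j (by simp [hji, hj])
        · refine .inr ⟨u - Pi.single i 1, fun j hj => ?_, ?_⟩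
          · simp [hu j hj]
          · exact add_tsub_cancel_of_le (single_le_of_le_apply hui)
      · rintro (hu | ⟨v, hv, rfl⟩) j hj
        · exact hu j fun hjt => hj (Finset.mem_insert_of_mem hjt)
        · have hji : j ≠ i := fun h => hj (h ▸ Finset.mem_insert_self i t)
          simp [hv j hj, hji]
    have hdisj : Disjoint E ((Pi.single i 1 + ·) '' E') := by
      rw [Set.disjoint_left]
      rintro _ hu ⟨v, -, rfl⟩
      simpa using hu i hi
    refine .of_eq_add_X_pow_mul (hd i) ih ?_
    rw [← countSeries_image (add_right_injective (Pi.single i 1)).injOn fun u _ => map_add d _ u,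
      ← countSeries_union (finiteFibers_orthant hd _) (finiteFibers_orthant hd _) hdisj, ← hE']

theorem isRationalSeries_countSeries_univ (hd : ∀ i, 0 < d (Pi.single i 1)) :
    IsRationalSeries (countSeries d Set.univ) := by
  have := Fintype.ofFinite ι
  simpa using isRationalSeries_countSeries_face hd Finset.univ

theorem isRationalSeries_countSeries_Ici (hd : ∀ i, 0 < d (Pi.single i 1)) (v : ι → ℕ) :
    IsRationalSeries (countSeries d (Set.Ici v)) := by
  have hIci : Set.Ici v = (v + ·) '' Set.univ := by
    ext u
    simp [le_iff_exists_add, eq_comm]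
  rw [hIci, countSeries_image (add_right_injective v).injOn fun u _ => map_add d v u]
  exact (isRationalSeries_X_pow _).mul (isRationalSeries_countSeries_univ hd)

theorem isRationalSeries_countSeries_of_isUpperSet (hd : ∀ i, 0 < d (Pi.single i 1))
    {U : Set (ι → ℕ)} (hU : IsUpperSet U) : IsRationalSeries (countSeries d U) := by
  obtain ⟨K, hK, rfl⟩ := exists_finite_eq_biUnion_Ici hU
  refine isRationalSeries_countSeries_biUnion (𝒞 := Set.range Set.Ici) ?_
    (fun X _ => finiteFibers_orthant hd X) ?_ hK fun k _ => Set.mem_range_self k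
  · rintro _ ⟨u, rfl⟩ _ ⟨v, rfl⟩
    exact ⟨u ⊔ v, Set.Ici_inter_Ici.symm⟩
  · rintro _ ⟨v, rfl⟩
    exact isRationalSeries_countSeries_Ici hd v

theorem isRationalSeries_countSeries_compl_of_isUpperSet (hd : ∀ i, 0 < d (Pi.single i 1))
    {U : Set (ι → ℕ)} (hU : IsUpperSet U) : IsRationalSeries (countSeries d Uᶜ) := by
  have hcount : countSeries d U + countSeries d Uᶜ = countSeries d Set.univ := by
    rw [← countSeries_union (finiteFibers_orthant hd U) (finiteFibers_orthant hd Uᶜ)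
      disjoint_compl_right, Set.union_compl_self]
  rw [eq_sub_of_add_eq' hcount]
  exact (isRationalSeries_countSeries_univ hd).sub
    (isRationalSeries_countSeries_of_isUpperSet hd hU)

end Orthant

section Transversal

variable {ι B : Type*} [Finite ι] [AddCommMonoid B]

/-- The points of a fibre of `φ` that are not lexicographically minimal form an upper set because
the lexicographic order is invariant under translation. -/
theorem exists_isUpperSet_bijOn_compl (φ : (ι → ℕ) →+ B) :
    ∃ U : Set (ι → ℕ), IsUpperSet U ∧ Set.BijOn φ Uᶜ (Set.range φ) := by
  classical
  let _ : LinearOrder ι := linearOrderOfSTO WellOrderingRel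
  let U : Set (ι → ℕ) := {u | ∃ v, toLex v < toLex u ∧ φ v = φ u}
  refine ⟨U, ?_, fun u _ => Set.mem_range_self u, ?_, ?_⟩
  · rintro u w huw ⟨v, hvu, hφ⟩
    obtain ⟨z, rfl⟩ := exists_add_of_le huw
    exact ⟨v + z, add_lt_add_left hvu (toLex z), by rw [map_add, map_add, hφ]⟩
  · intro u hu v hv hφ
    rcases lt_trichotomy (toLex u) (toLex v) with h | h | h
    · exact (hv ⟨u, h, hφ⟩).elim
    · exact toLex.injective h
    · exact (hu ⟨v, h, hφ.symm⟩).elim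
  · rintro _ ⟨u, rfl⟩
    obtain ⟨v, hv, hmin⟩ := (wellFounded_lt (α := Lex (ι → ℕ))).has_min
      {v | φ (ofLex v) = φ u} ⟨toLex u, rfl⟩
    exact ⟨ofLex v, fun ⟨w, hw, hφ⟩ => hmin (toLex w) (hφ.trans hv) hw, hv⟩

end Transversal

section FiniteTranslates

variable {B : Type*} [AddCommMonoid B] {ℓ : B →+ ℕ}

/-- A finite union of translates of one finitely generated submonoid whose nonzero elements have
positive degree. Unlike linear sets, these sets are closed under intersection. -/
def IsFiniteTranslates (ℓ : B →+ ℕ) (X : Set B) : Prop :=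
  ∃ (F : Set B) (P : AddSubmonoid B), F.Finite ∧ P.FG ∧ (∀ p ∈ P, p ≠ 0 → 0 < ℓ p) ∧
    X = F + (P : Set B)

theorem exists_mrange_eq_of_fg_of_pos {P : AddSubmonoid B} (hP : P.FG)
    (hpos : ∀ p ∈ P, p ≠ 0 → 0 < ℓ p) :
    ∃ (n : ℕ) (φ : (Fin n → ℕ) →+ B), AddMonoidHom.mrange φ = P ∧
      ∀ i, 0 < ℓ.comp φ (Pi.single i 1) := by
  classical
  obtain ⟨s, rfl⟩ := hP
  let e : Fin _ ≃ s.erase 0 := (s.erase 0).equivFin.symm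
  have hrange : Set.range (fun i => (e i : B)) = (s : Set B) \ {0} := by
    rw [← Finset.coe_erase, ← Subtype.range_coe (s := ((s.erase 0 : Finset B) : Set B))]
    exact e.surjective.range_comp Subtype.val
  refine ⟨_, (Fintype.linearCombination ℕ fun i => (e i : B)).toAddMonoidHom, ?_, fun i => ?_⟩
  · ext x
    rw [← closure_sdiff_singleton_zero (s : Set B), ← hrange, mem_closure_range_iff_of_fintype]
    exact exists_congr fun _ => eq_comm
  · have hi : 0 < ℓ (e i) := hpos _ (subset_closure (Finset.mem_of_mem_erase (e i).2))
      (Finset.ne_of_mem_erase (e i).2)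
    simpa [Fintype.linearCombination_apply_single] using hi

theorem IsFiniteTranslates.finiteFibers {X : Set B} (hX : IsFiniteTranslates ℓ X) :
    FiniteFibers ℓ X := by
  obtain ⟨F, P, hF, hP, hpos, rfl⟩ := hX
  obtain ⟨n, φ, rfl, hφ⟩ := exists_mrange_eq_of_fg_of_pos hP hpos
  rw [← Set.iUnion_add_left_image]
  refine .biUnion hF fun f _ => ?_
  rw [AddMonoidHom.coe_mrange, ← Set.range_comp, ← Set.image_univ]
  exact (finiteFibers_orthant hφ _).image fun u _ => map_add ℓ f (φ u)

theorem exists_finite_setOfPred_add_eq_add [IsCancelAdd B] {M : Type*} [AddCommMonoid M]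
    [PartialOrder M] [WellQuasiOrderedLE M] [ExistsAddOfLE M] (φ ψ : M →+ B) (f g : B) :
    ∃ K : Set M, K.Finite ∧ {z | f + φ z = g + ψ z} = K + (φ.eqLocusM ψ : Set M) := by
  set E : Set M := {z | f + φ z = g + ψ z}
  refine ⟨_, finite_setOfPred_minimal_mem E, Set.Subset.antisymm (fun z hz => ?_) ?_⟩
  · obtain ⟨k, hkz, hk⟩ := exists_minimal_le_of_wellFoundedLT (· ∈ E) z hz
    obtain ⟨v, rfl⟩ := exists_add_of_le hkz
    refine Set.add_mem_add hk (add_left_cancel (a := f + φ k) ?_)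
    calc f + φ k + φ v = f + φ (k + v) := by rw [map_add, add_assoc]
      _ = g + ψ (k + v) := hz
      _ = g + ψ k + ψ v := by rw [map_add, add_assoc]
      _ = f + φ k + ψ v := by rw [show f + φ k = g + ψ k from hk.prop]
  · rintro _ ⟨k, hk, v, hv, rfl⟩
    calc f + φ (k + v) = f + φ k + φ v := by rw [map_add, add_assoc]
      _ = g + ψ k + ψ v := congrArg₂ (· + ·) hk.prop hv
      _ = g + ψ (k + v) := by rw [map_add, add_assoc]

theorem nsmul_left_injective_of_mem_closure {t : Set B} (ht : LinearIndepOn ℕ id t) {p : B}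
    (hp : p ∈ closure t) (hp₀ : p ≠ 0) : Function.Injective (· • p : ℕ → B) := by
  rw [← Subtype.range_coe (s := t)] at hp
  obtain ⟨c, rfl⟩ := exists_finsupp_of_mem_closure_range _ _ hp
  have hc : c ≠ 0 := by
    rintro rfl
    exact hp₀ Finsupp.sum_zero_index
  obtain ⟨i, hi⟩ := Finsupp.ne_iff.1 hc
  have hli : LinearIndependent ℕ (Subtype.val : t → B) := ht
  intro m n hmn
  have hmul : m • c = n • c := hli (by rw [map_nsmul, map_nsmul]; exact hmn)
  exact Nat.eq_of_mul_eq_mul_right (Nat.pos_of_ne_zero hi) (DFunLike.congr_fun hmul i)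

section Inter

variable {M N : Type*} [AddCommMonoid M] [AddCommMonoid N]

theorem mrange_inf_mrange (φ : M →+ B) (ψ : N →+ B) :
    AddMonoidHom.mrange φ ⊓ AddMonoidHom.mrange ψ =
      ((φ.comp (.fst M N)).eqLocusM (ψ.comp (.snd M N))).map (φ.comp (.fst M N)) := by
  ext x
  constructor
  · rintro ⟨⟨a, ha⟩, b, hb⟩
    exact ⟨(a, b), ha.trans hb.symm, ha⟩
  · rintro ⟨⟨a, b⟩, hab, rfl⟩
    exact ⟨⟨a, rfl⟩, b, hab.symm⟩

theorem exists_finite_vadd_mrange_inter_vadd_mrange [IsCancelAdd B]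
    [PartialOrder M] [WellQuasiOrderedLE M] [ExistsAddOfLE M]
    [PartialOrder N] [WellQuasiOrderedLE N] [ExistsAddOfLE N] (φ : M →+ B) (ψ : N →+ B) (f g : B) :
    ∃ K : Set B, K.Finite ∧
      (f +ᵥ (AddMonoidHom.mrange φ : Set B)) ∩ (g +ᵥ (AddMonoidHom.mrange ψ : Set B)) =
        K + ((AddMonoidHom.mrange φ ⊓ AddMonoidHom.mrange ψ : AddSubmonoid B) : Set B) := by
  obtain ⟨K, hK, hKeq⟩ :=
    exists_finite_setOfPred_add_eq_add (φ.comp (.fst M N)) (ψ.comp (.snd M N)) f g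
  refine ⟨f +ᵥ φ.comp (.fst M N) '' K, (hK.image _).vadd_set, ?_⟩
  rw [mrange_inf_mrange, AddSubmonoid.coe_map, vadd_add_assoc, ← Set.image_add, ← hKeq]
  ext x
  constructor
  · rintro ⟨⟨_, ⟨a, rfl⟩, rfl⟩, _, ⟨b, rfl⟩, hab⟩
    exact ⟨_, ⟨(a, b), hab.symm, rfl⟩, rfl⟩
  · rintro ⟨_, ⟨⟨a, b⟩, hab, rfl⟩, rfl⟩
    exact ⟨⟨_, ⟨a, rfl⟩, rfl⟩, _, ⟨b, rfl⟩, hab.symm⟩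

end Inter

variable [IsCancelAdd B]

theorem infClosed_isFiniteTranslates : InfClosed {X | IsFiniteTranslates ℓ X} := by
  rintro _ ⟨F, P, hF, hP, hpos, rfl⟩ _ ⟨G, Q, hG, hQ, -, rfl⟩
  obtain ⟨m, φ, rfl⟩ := fg_iff_exists_fin_addMonoidHom.1 hP
  obtain ⟨n, ψ, rfl⟩ := fg_iff_exists_fin_addMonoidHom.1 hQ
  choose K hK hKeq using exists_finite_vadd_mrange_inter_vadd_mrange φ ψ
  refine ⟨⋃ f ∈ F, ⋃ g ∈ G, K f g, AddMonoidHom.mrange φ ⊓ AddMonoidHom.mrange ψ,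
    hF.biUnion fun f _ => hG.biUnion fun g _ => hK f g, ?_, fun p hp => hpos p hp.1, ?_⟩
  · rw [mrange_inf_mrange]
    exact (fg_eqLocusM _ _).map _
  · simp only [Set.inf_eq_inter, Set.iUnion_add, ← hKeq]
    rw [← Set.iUnion_add_left_image, ← Set.iUnion_add_left_image, Set.iUnion₂_inter]
    simp only [Set.inter_iUnion₂]
    rfl

theorem isRationalSeries_countSeries_vadd_sdiff {P : AddSubmonoid B} (hP : P.FG)
    (hpos : ∀ p ∈ P, p ≠ 0 → 0 < ℓ p) (f : B) {Y : Set B} (hY : ∀ y ∈ Y, ∀ p ∈ P, y + p ∈ Y) :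
    IsRationalSeries (countSeries ℓ ((f +ᵥ (P : Set B)) \ Y)) := by
  obtain ⟨n, φ, rfl, hφ⟩ := exists_mrange_eq_of_fg_of_pos hP hpos
  obtain ⟨U, hU, hbij⟩ := exists_isUpperSet_bijOn_compl φ
  set V : Set (Fin n → ℕ) := U ∪ {u | f + φ u ∈ Y}
  have hV : IsUpperSet V := by
    refine hU.union fun u v huv hu => ?_
    obtain ⟨w, rfl⟩ := exists_add_of_le huv
    have := hY _ hu (φ w) ⟨w, rfl⟩
    rwa [add_assoc, ← map_add] at this
  have hinj : Set.InjOn (fun u => f + φ u) Vᶜ := fun u hu v hv huv =>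
    hbij.injOn (fun h => hu (.inl h)) (fun h => hv (.inl h)) (add_left_cancel huv)
  have himage : (f +ᵥ (AddMonoidHom.mrange φ : Set B)) \ Y = (fun u => f + φ u) '' Vᶜ := by
    ext x
    constructor
    · rintro ⟨⟨_, hy, rfl⟩, hx⟩
      obtain ⟨u, hu, rfl⟩ := hbij.surjOn hy
      exact ⟨u, fun h => h.elim hu hx, rfl⟩
    · rintro ⟨u, hu, rfl⟩
      exact ⟨⟨_, ⟨u, rfl⟩, rfl⟩, fun h => hu (.inr h)⟩
  rw [himage, countSeries_image hinj fun u _ => map_add ℓ f (φ u)]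
  exact (isRationalSeries_X_pow _).mul (isRationalSeries_countSeries_compl_of_isUpperSet hφ hV)

theorem IsFiniteTranslates.isRationalSeries_countSeries {X : Set B}
    (hX : IsFiniteTranslates ℓ X) : IsRationalSeries (countSeries ℓ X) := by
  obtain ⟨F, P, hF, hP, hpos, rfl⟩ := hX
  induction F, hF using Set.Finite.induction_on with
  | empty => simpa using isRationalSeries_zero
  | @insert f F _ hF ih =>
    have hinsert : insert f F + (P : Set B) =
        (f +ᵥ (P : Set B)) \ (F + (P : Set B)) ∪ (F + (P : Set B)) := by
      rw [Set.insert_eq, Set.union_add, Set.singleton_add, Set.sdiff_union_self]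
      rfl
    have hfin : FiniteFibers ℓ (insert f F + (P : Set B)) :=
      IsFiniteTranslates.finiteFibers ⟨_, P, hF.insert f, hP, hpos, rfl⟩
    rw [hinsert] at hfin ⊢
    rw [countSeries_union (hfin.mono Set.subset_union_left) (hfin.mono Set.subset_union_right)
      Set.disjoint_sdiff_left]
    refine (isRationalSeries_countSeries_vadd_sdiff hP hpos f ?_).add ih
    rintro _ ⟨g, hg, m, hm, rfl⟩ p hp
    exact ⟨g, hg, m + p, add_mem hm hp, (add_assoc _ _ _).symm⟩

theorem isFiniteTranslates_of_isProperLinearSet {X : Set B} (hX : IsProperLinearSet X)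
    (hfin : FiniteFibers ℓ X) : IsFiniteTranslates ℓ X := by
  obtain ⟨a, t, ht, rfl⟩ := isProperLinearSet_iff.1 hX
  refine ⟨{a}, closure t, Set.finite_singleton a, ⟨t, rfl⟩, fun p hp hp₀ => ?_,
    Set.singleton_add.symm⟩
  by_contra! hℓ
  refine Set.infinite_of_injective_forall_mem (f := fun n : ℕ => a + n • p)
    ((add_right_injective a).comp (nsmul_left_injective_of_mem_closure ht hp hp₀)) (fun n => ?_)
    (hfin (ℓ a))
  exact ⟨⟨n • p, nsmul_mem hp n, rfl⟩, by simp [Nat.le_zero.1 hℓ]⟩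

theorem isRationalSeries_countSeries_of_isSemilinearSet {X : Set B} (hX : IsSemilinearSet X)
    (hfin : FiniteFibers ℓ X) : IsRationalSeries (countSeries ℓ X) := by
  obtain ⟨T, hT, rfl⟩ := isProperSemilinearSet_iff.1 hX.isProperSemilinearSet
  rw [Set.sUnion_eq_biUnion] at hfin ⊢
  exact isRationalSeries_countSeries_biUnion infClosed_isFiniteTranslates
    (fun X hX => IsFiniteTranslates.finiteFibers hX)
    (fun X hX => IsFiniteTranslates.isRationalSeries_countSeries hX) T.finite_toSet
    fun Y hY => isFiniteTranslates_of_isProperLinearSet (hT Y hY)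
      (hfin.mono (Set.subset_biUnion_of_mem (u := fun s => s) hY))

end FiniteTranslates

section Paths

variable {Q B : Type*} [AddCommMonoid B]

/-- `PathLabel L T p q x` says that `x` is the sum of the labels of a nonempty path from `p` to `q`
whose intermediate vertices lie in `T`, where `L p q` is the set of labels of edges `p → q`. -/
inductive PathLabel (L : Q → Q → Set B) (T : Set Q) (p : Q) : Q → B → Prop
  | single {q : Q} {x : B} (h : x ∈ L p q) : PathLabel L T p q x
  | snoc {m q : Q} {x y : B} (h : PathLabel L T p m x) (hm : m ∈ T) (hy : y ∈ L m q) :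
      PathLabel L T p q (x + y)

variable {L : Q → Q → Set B} {T : Set Q} {p q r : Q} {x y : B}

theorem PathLabel.mono {T' : Set Q} (hT : T ⊆ T') (h : PathLabel L T p q x) :
    PathLabel L T' p q x := by
  induction h with
  | single h => exact .single h
  | snoc _ hm hy ih => exact .snoc ih (hT hm) hy

theorem PathLabel.append (h : PathLabel L T p r x) (hr : r ∈ T) (h' : PathLabel L T r q y) :
    PathLabel L T p q (x + y) := by
  induction h' with
  | single h' => exact .snoc h hr h'
  | snoc _ hm hy ih =>
    rw [← add_assoc]
    exact .snoc ih hm hy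

theorem PathLabel.add_mem_closure (h : PathLabel L T p r x) (hr : r ∈ T)
    (hy : y ∈ closure {y | PathLabel L T r r y}) : PathLabel L T p r (x + y) := by
  induction hy using closure_induction generalizing x with
  | mem y hy => exact h.append hr hy
  | zero => rwa [add_zero]
  | add y z _ _ ihy ihz =>
    rw [← add_assoc]
    exact ihz (ihy h)

theorem setOfPred_pathLabel_empty : {x | PathLabel L ∅ p q x} = L p q := by
  ext x
  constructor
  · rintro (h | ⟨_, h, _⟩)
    · exact h
    · exact h.elim
  · exact .single

/-- Kleene's recursion: a path through `insert r T` either avoids `r` as an intermediate vertex or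
splits at its visits to `r`. -/
theorem setOfPred_pathLabel_insert :
    {x | PathLabel L (insert r T) p q x} = {x | PathLabel L T p q x} ∪
      ({x | PathLabel L T p r x} + (closure {x | PathLabel L T r r x} : Set B) +
        {x | PathLabel L T r q x}) := by
  have hT : T ⊆ insert r T := Set.subset_insert r T
  refine Set.Subset.antisymm (fun x h => ?_) ?_
  · change PathLabel L (insert r T) p q x at h
    induction h with
    | single h => exact .inl (.single h)
    | @snoc m q x y _ hm hy ih =>
      rcases hm with rfl | hm
      · refine .inr ?_
        rcases ih with hx | ⟨_, ⟨a, ha, b, hb, rfl⟩, c, hc, rfl⟩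
        · exact ⟨_, ⟨x, hx, 0, zero_mem _, add_zero x⟩, y, .single hy, rfl⟩
        · exact ⟨_, ⟨a, ha, b + c, add_mem hb (subset_closure hc), (add_assoc a b c).symm⟩,
            y, .single hy, rfl⟩
      · rcases ih with hx | ⟨_, hab, c, hc, rfl⟩
        · exact .inl (.snoc hx hm hy)
        · exact .inr ⟨_, hab, c + y, .snoc hc hm hy, (add_assoc _ _ _).symm⟩
  · rintro x (h | ⟨_, ⟨a, ha, b, hb, rfl⟩, c, hc, rfl⟩)
    · exact h.mono hT
    · have hr : r ∈ insert r T := Set.mem_insert r T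
      have hb' := closure_mono (fun _ hx => PathLabel.mono hT hx) hb
      exact ((PathLabel.mono hT ha).add_mem_closure hr hb').append hr (PathLabel.mono hT hc)

theorem isSemilinearSet_pathLabel (hL : ∀ p q, IsSemilinearSet (L p q)) (hT : T.Finite) (p q : Q) :
    IsSemilinearSet {x | PathLabel L T p q x} := by
  induction T, hT using Set.Finite.induction_on generalizing p q with
  | empty =>
    rw [setOfPred_pathLabel_empty]
    exact hL p q
  | insert _ _ ih =>
    rw [setOfPred_pathLabel_insert]
    exact (ih p q).union (((ih p _).add (ih _ _).closure).add (ih _ q))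

end Paths

section Least

variable {B : Type*} [AddCommMonoid B]

theorem isSemilinearSet_setOfPred_isLeast {W : Set (B × ℕ)} (hW : IsSemilinearSet W) :
    IsSemilinearSet {x : B × ℕ | IsLeast {n | (x.1, n) ∈ W} x.2} := by
  have habove : ∀ x : B × ℕ, x ∈ W + AddMonoidHom.inr B ℕ '' {0}ᶜ ↔ ∃ n < x.2, (x.1, n) ∈ W := by
    rintro ⟨b, k⟩
    constructor
    · rintro ⟨⟨b, n⟩, hbn, _, ⟨m, hm, rfl⟩, hbk⟩
      obtain ⟨rfl, rfl⟩ : b + 0 = _ ∧ n + m = k := Prod.ext_iff.1 hbk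
      rw [add_zero]
      exact ⟨n, Nat.lt_add_of_pos_right (Nat.pos_of_ne_zero hm), hbn⟩
    · rintro ⟨n, hn, hbn⟩
      exact ⟨_, hbn, _, ⟨k - n, (Nat.sub_pos_of_lt hn).ne', rfl⟩,
        Prod.ext (add_zero b) (Nat.add_sub_of_le hn.le)⟩
  have hleast : {x : B × ℕ | IsLeast {n | (x.1, n) ∈ W} x.2} =
      W \ (W + AddMonoidHom.inr B ℕ '' {0}ᶜ) := by
    ext x
    refine and_congr Iff.rfl ?_
    rw [habove]
    push Not
    exact ⟨fun h n hn hxn => (h hxn).not_gt hn, fun h n hxn => not_lt.1 fun hn => h n hn hxn⟩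
  rw [hleast]
  exact hW.sdiff (hW.add ((IsSemilinearSet.singleton 0).compl.image _))

end Least

section VirtuallyAbelian

open scoped IsMulCommutative

variable {G : Type*} [Group G] {S : Finset G} {A : Subgroup G} {ω : S → ℕ} {W : Set (List S)}
  {p q m : G ⧸ A}

theorem weight_eq_iff_isLeast (hS : Submonoid.closure (S : Set G) = ⊤) {g : G} {n : ℕ} :
    weight ω g = n ↔ IsLeast {n | ∃ w : List S, wordValue w = g ∧ wordWeight ω w = n} n := by
  have hleast : IsLeast {n | ∃ w : List S, wordValue w = g ∧ wordWeight ω w = n} (weight ω g) :=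
    ⟨exists_word_weight hS ω g, fun _ => Nat.sInf_le⟩
  exact ⟨fun h => h ▸ hleast, hleast.unique⟩

/-- Multiplication by the representative `p.out` identifies `G` with the disjoint union of the
cosets `q` of `A`; `cosetElement p q a` is the element of `G` whose coordinate in the coset `q`
is `a`. Allowing an arbitrary base point `p` makes these coordinates additive along words. -/
noncomputable def cosetElement (p q : G ⧸ A) (a : Additive A) : G := q.out * a.toMul * p.out⁻¹

theorem cosetElement_mul_cosetElement (a b : Additive A) :
    cosetElement m q b * cosetElement p m a = cosetElement p q (b + a) := by
  simp [cosetElement, mul_assoc]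

theorem cosetElement_injective : Function.Injective (cosetElement p q) := by
  intro a b h
  simpa [cosetElement] using h

theorem mk_cosetElement_mul_out (a : Additive A) :
    (QuotientGroup.mk (cosetElement p q a * p.out) : G ⧸ A) = q := by
  rw [cosetElement, inv_mul_cancel_right, QuotientGroup.mk_mul_of_mem _ a.toMul.2,
    QuotientGroup.out_eq']

theorem exists_cosetElement_eq (p : G ⧸ A) (g : G) : ∃ q a, cosetElement p q a = g := by
  let q : G ⧸ A := QuotientGroup.mk (g * p.out)
  have hmem : q.out⁻¹ * (g * p.out) ∈ A := QuotientGroup.eq.1 (QuotientGroup.out_eq' q)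
  exact ⟨q, .ofMul ⟨_, hmem⟩, by simp [cosetElement]⟩

/-- Pairs of the coordinate and the weight of the elements of the coset `q` (based at `p`)
represented by words in `W`. -/
def wordLabels (ω : S → ℕ) (W : Set (List S)) (p q : G ⧸ A) : Set (Additive A × ℕ) :=
  {x | ∃ w ∈ W, wordValue w = cosetElement p q x.1 ∧ wordWeight ω w = x.2}

theorem finite_wordLabels (hW : W.Finite) : (wordLabels ω W p q).Finite := by
  refine (hW.biUnion (t := fun w => {x | wordValue w = cosetElement p q x.1 ∧
    wordWeight ω w = x.2}) fun w _ => Set.Subsingleton.finite ?_).subset ?_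
  · exact fun x hx y hy =>
      Prod.ext (cosetElement_injective (hx.1.symm.trans hy.1)) (hx.2.symm.trans hy.2)
  · rintro x ⟨w, hw, hx⟩
    exact Set.mem_biUnion hw hx

theorem add_mem_wordLabels_univ {x y : Additive A × ℕ} (hx : x ∈ wordLabels ω .univ p m)
    (hy : y ∈ wordLabels ω .univ m q) : y + x ∈ wordLabels ω .univ p q := by
  obtain ⟨v, -, hv, hvx⟩ := hx
  obtain ⟨w, -, hw, hwy⟩ := hy
  refine ⟨w ++ v, trivial, ?_, ?_⟩
  · rw [Prod.fst_add, ← cosetElement_mul_cosetElement, ← hv, ← hw]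
    simp [wordValue]
  · rw [Prod.snd_add, ← hvx, ← hwy]
    simp [wordWeight]

/-- The graph of the weight function on the coset `q`, in the coordinates based at `p`. -/
def weightGraph (ω : S → ℕ) (p q : G ⧸ A) : Set (Additive A × ℕ) :=
  {x | weight ω (cosetElement p q x.1) = x.2}

theorem injOn_weightGraph : Set.InjOn (fun x => cosetElement p q x.1) (weightGraph ω p q) :=
  fun _ hx _ hy hxy => Prod.ext (cosetElement_injective hxy)
    (hx.symm.trans ((congrArg (weight ω) hxy).trans hy))

variable [IsMulCommutative A]

theorem wordLabels_univ :
    wordLabels ω .univ p q =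
      {x | PathLabel (wordLabels ω {w | w.length ≤ 1}) .univ p q x} := by
  refine Set.Subset.antisymm ?_ fun x hx => ?_
  · rintro x ⟨w, -, hw, hx⟩
    induction w generalizing q x with
    | nil => exact .single ⟨[], Nat.zero_le 1, hw, hx⟩
    | cons s w ih =>
      obtain ⟨m, a, ha⟩ := exists_cosetElement_eq p (wordValue w)
      have hletter : wordValue [s] = cosetElement m q (x.1 - a) := by
        refine mul_right_cancel (b := cosetElement p m a) ?_
        rw [cosetElement_mul_cosetElement, sub_add_cancel, ← hw, ha]
        simp [wordValue]
      have hsplit : x = (a, wordWeight ω w) + (x.1 - a, wordWeight ω [s]) := by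
        refine Prod.ext (add_sub_cancel a x.1).symm ?_
        rw [← hx]
        simp [wordWeight, add_comm]
      rw [hsplit]
      exact .snoc (ih (x := (a, wordWeight ω w)) ha.symm rfl) trivial ⟨[s], le_refl 1, hletter, rfl⟩
  · change PathLabel _ _ _ _ _ at hx
    induction hx with
    | single hx =>
      obtain ⟨w, -, hw⟩ := hx
      exact ⟨w, trivial, hw⟩
    | snoc _ _ hy ih =>
      obtain ⟨w, -, hw⟩ := hy
      rw [add_comm]
      exact add_mem_wordLabels_univ ih ⟨w, trivial, hw⟩

theorem isSemilinearSet_wordLabels_univ [A.FiniteIndex] :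
    IsSemilinearSet (wordLabels ω .univ p q) := by
  rw [wordLabels_univ]
  exact isSemilinearSet_pathLabel
    (fun _ _ => .of_finite (finite_wordLabels (List.finite_length_le S 1))) Set.finite_univ p q

theorem isSemilinearSet_weightGraph [A.FiniteIndex] (hS : Submonoid.closure (S : Set G) = ⊤) :
    IsSemilinearSet (weightGraph ω p q) := by
  have hgraph : weightGraph ω p q =
      {x | IsLeast {n | (x.1, n) ∈ wordLabels ω .univ p q} x.2} := by
    ext x
    simp only [weightGraph, wordLabels, Set.mem_ofPred_eq, Set.mem_univ, true_and,
      weight_eq_iff_isLeast hS]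
  rw [hgraph]
  exact isSemilinearSet_setOfPred_isLeast isSemilinearSet_wordLabels_univ

theorem isRationalSeries_countSeries_image_cosetElement [A.FiniteIndex]
    (hS : Submonoid.closure (S : Set G) = ⊤) (hω : ∀ s, 0 < ω s) [AddMonoid.FG (Additive A)]
    {X : Set (Additive A)} (hX : IsSemilinearSet X) :
    IsRationalSeries (countSeries (weight ω) (cosetElement p q '' X)) := by
  let f : Additive A × ℕ → G := fun x => cosetElement p q x.1
  let Z : Set (Additive A × ℕ) := weightGraph ω p q ∩ AddMonoidHom.fst (Additive A) ℕ ⁻¹' X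
  have hZ : IsSemilinearSet Z := (isSemilinearSet_weightGraph hS).inter (hX.preimage _)
  have himage : cosetElement p q '' X = f '' Z := by
    ext g
    constructor
    · rintro ⟨a, ha, rfl⟩
      exact ⟨(a, weight ω (cosetElement p q a)), ⟨rfl, ha⟩, rfl⟩
    · rintro ⟨x, hx, rfl⟩
      exact ⟨x.1, hx.2, rfl⟩
  have hinj : Set.InjOn f Z := injOn_weightGraph.mono Set.inter_subset_left
  have hweight : ∀ x ∈ Z, weight ω (f x) = 0 + AddMonoidHom.snd (Additive A) ℕ x :=
    fun x hx => hx.1.trans (zero_add _).symm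
  have hfin : FiniteFibers (weight ω) (f '' Z) := finite_weight_eq hS ω hω _
  rw [himage, countSeries_image hinj hweight, pow_zero, one_mul]
  exact isRationalSeries_countSeries_of_isSemilinearSet hZ (hfin.of_image hinj hweight)

theorem isRationalSeries_relGrowthSeries [A.FiniteIndex]
    (hS : Submonoid.closure (S : Set G) = ⊤) (hω : ∀ s, 0 < ω s) [AddMonoid.FG (Additive A)]
    (p : G ⧸ A) {U : Set G} (hU : ∀ q, IsSemilinearSet (cosetElement p q ⁻¹' U)) :
    IsRationalSeries (relGrowthSeries ω U) := by
  have := Fintype.ofFinite (G ⧸ A)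
  have hcosets : U = ⋃ q, cosetElement p q '' (cosetElement p q ⁻¹' U) := by
    refine Set.Subset.antisymm (fun g hg => ?_) ?_
    · obtain ⟨q, a, rfl⟩ := exists_cosetElement_eq p g
      exact Set.mem_iUnion.2 ⟨q, a, hg, rfl⟩
    · exact Set.iUnion_subset fun q => Set.image_preimage_subset _ _
  have hdisj : Pairwise
      (Function.onFun Disjoint fun q => cosetElement p q '' (cosetElement p q ⁻¹' U)) := by
    intro q q' hqq'
    refine Set.disjoint_left.2 ?_
    rintro _ ⟨a, -, rfl⟩ ⟨b, -, hab⟩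
    refine hqq' ?_
    calc q = QuotientGroup.mk (cosetElement p q a * p.out) := (mk_cosetElement_mul_out a).symm
      _ = QuotientGroup.mk (cosetElement p q' b * p.out) := by rw [← hab]
      _ = q' := mk_cosetElement_mul_out b
  change IsRationalSeries (countSeries (weight ω) U)
  rw [hcosets, countSeries_iUnion (fun q => finite_weight_eq hS ω hω _) hdisj]
  exact isRationalSeries_sum _ fun q _ =>
    isRationalSeries_countSeries_image_cosetElement hS hω (hU q)

theorem isSemilinearSet_coe_addSubgroup {B : Type*} [AddCommGroup B] [AddGroup.FG B]
    (K : AddSubgroup B) : IsSemilinearSet (K : Set B) := by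
  have : Module.Finite ℤ B := Module.Finite.iff_addGroup_fg.2 ‹_›
  have hK := IsNoetherian.noetherian (AddSubgroup.toIntSubmodule K)
  rw [Submodule.fg_iff_addSubgroup_fg, AddSubgroup.toIntSubmodule_toAddSubgroup,
    AddSubgroup.fg_iff_addSubmonoid_fg] at hK
  exact .of_fg hK

theorem isSemilinearSet_cosetElement_preimage_subgroup [AddGroup.FG (Additive A)]
    (H : Subgroup G) : IsSemilinearSet (cosetElement p q ⁻¹' (H : Set G)) := by
  rcases (cosetElement p q ⁻¹' (H : Set G)).eq_empty_or_nonempty with hempty | ⟨a, ha⟩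
  · rw [hempty]
    exact .empty
  · let K : AddSubgroup (Additive A) :=
      (H.comap ((MulAut.conj p.out).toMonoidHom.comp A.subtype)).toAddSubgroup
    have htranslate : cosetElement p q ⁻¹' (H : Set G) = a +ᵥ (K : Set (Additive A)) := by
      ext b
      have hb : cosetElement p q b = cosetElement p q a * cosetElement p p (-a + b) := by
        rw [cosetElement_mul_cosetElement, add_neg_cancel_left]
      rw [Set.mem_vadd_set_iff_neg_vadd_mem, Set.mem_preimage, hb, SetLike.mem_coe,
        H.mul_mem_cancel_left ha]
      rfl
    rw [htranslate]
    exact (isSemilinearSet_coe_addSubgroup K).vadd a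

theorem group_fg_of_closure_eq_top (hS : Submonoid.closure (S : Set G) = ⊤) : Group.FG G := by
  refine ⟨⟨S, ?_⟩⟩
  rw [← top_le_iff, ← Subgroup.toSubmonoid_le, Subgroup.top_toSubmonoid, ← hS]
  exact Submonoid.closure_le.2 Subgroup.subset_closure

end VirtuallyAbelian

end WeightedGrowth

theorem corollary3p4 {G : Type*} [Group G] (hG : WeightedGrowth.IsVirtuallyAbelian G)
    (S : Finset G) (hS : Submonoid.closure (S : Set G) = ⊤)
    (ω : S → ℕ) (hω : ∀ s, 0 < ω s)
    {ι : Type*} [Finite ι] (H : ι → Subgroup G) :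
    WeightedGrowth.IsRationalSeries
      (WeightedGrowth.relGrowthSeries ω (⋃ i, (H i : Set G))) := by
  obtain ⟨A, _, _⟩ := hG
  have := WeightedGrowth.group_fg_of_closure_eq_top hS
  let p : G ⧸ A := QuotientGroup.mk 1
  open scoped IsMulCommutative in
    refine WeightedGrowth.isRationalSeries_relGrowthSeries hS hω p fun q => ?_
    rw [Set.preimage_iUnion]
    exact .iUnion fun i => WeightedGrowth.isSemilinearSet_cosetElement_preimage_subgroup (H i)
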